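/- For a probability measure $P$ on a measurable space $(\Omega,\mathcal F)$, $\tau>0$ and a measurable $X:\Omega\to[-B,B]$ let $$\mathcal R^P(X)=\sup\{\mathbb E_Q[X] : Q \text{ a probability measure},\ \mathrm{KL}(Q\,\|\,P)\le\tau\},$$ and let $\mathcal R_n(X)=\mathcal R^{P_n}(X)$ be its sample average approximation (SAA), where $P_n=\frac1n\sum_{i=1}^n\delta_{\omega_i}$ is the empirical distribution of $n$ independent samples from $P$. Put $$f(\epsilon)=\frac{2B}{\epsilon}\,\exp\!\Big(\frac{2B\tau}{\epsilon}\Big),$$ where $2B$ is the length of the range $[-B,B]$ (so $f(\epsilon)=\exp(\tau/\epsilon)/\epsilon$ when the range has length one). (1) Upper bound, $n=\tilde{O}(f(\epsilon))$. There is an absolute $k\in\mathbb N$, and for every $\tau>0$ there is a constant $C>0$ depending only on $\tau$, such that for all $(\Omega,\mathcal F)$, $P$, $B$, $X$ as above, all $0<\epsilon\le B$, all $\delta\in(0,1)$ and all $$n\ge C\,f(\epsilon)\,\big(\log f(\epsilon)\big)^k\,\log(2/\delta),$$ we have $|\mathcal R^P(X)-\mathcal R_n(X)|\le\epsilon$ with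 probability at least $1-\delta$. In particular the number of samples does not depend on $P$. (2) Optimality. Let $\tau>0$, $0<\epsilon\le B$, $\Omega=\{\omega_1,\omega_2\}$, $X(\omega_1)=B$, $X(\omega_2)=-B$, and let $n\le f(\epsilon)/2$. Then for every estimator $\hat{\mathcal R}_n:\Omega^n\to\mathbb R$ there is a probability measure $P$ on $\Omega$ such that $|\mathcal R^P(X)-\hat{\mathcal R}_n|>\epsilon/2$ with probability at least $1/2$ under $P^{\otimes n}$; and, if $n\ge1$, there is a $P$ such that $|\mathcal R^P(X)-\mathcal R_n(X)|>\epsilon$ with probability at least $1/2$ under $P^{\otimes n}$. -/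

import Mathlib

open MeasureTheory

noncomputable section

/-- The worst-case expectation of `X` over the Kullback-Leibler ball of radius `τ` around `P`,
`sup {E_Q[X] : Q a probability measure, KL(Q ‖ P) ≤ τ}`.
(For a probability measure `P` and a bounded measurable `X`, the set is nonempty and bounded.) -/
def klRobust {Ω : Type*} [MeasurableSpace Ω] (P : Measure Ω) (τ : ℝ) (X : Ω → ℝ) : ℝ :=
  sSup {r : ℝ | ∃ Q : Measure Ω, IsProbabilityMeasure Q ∧
    InformationTheory.klDiv Q P ≤ ENNReal.ofReal τ ∧ r = ∫ ω, X ω ∂Q}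

/-- The empirical distribution `(1/n) ∑ i, δ_{s i}` of a sample `s` of size `n`. -/
def empiricalDistribution {Ω : Type*} [MeasurableSpace Ω] {n : ℕ} (s : Fin n → Ω) : Measure Ω :=
  (n : ENNReal)⁻¹ • ∑ i, Measure.dirac (s i)

/-- The sample average approximation: the worst-case expectation of `X` over the
Kullback-Leibler ball of radius `τ` around the empirical distribution of the sample. -/
def klSAA {Ω : Type*} [MeasurableSpace Ω] {n : ℕ} (τ : ℝ) (X : Ω → ℝ) (s : Fin n → Ω) : ℝ :=
  klRobust (empiricalDistribution s) τ X

/-- The rate `(2B/ε) exp(2Bτ/ε)`, where `2B` is the length of the range `[-B, B]`. -/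
def klRate (B τ ε : ℝ) : ℝ := (2 * B / ε) * Real.exp (2 * B * τ / ε)

end

/-! ### Exponential tilting and convex duality on the KL ball. -/

section Duality

open ProbabilityTheory InformationTheory Real Set

variable {Ω : Type*} [MeasurableSpace Ω] {P : Measure Ω}
  {X : Ω → ℝ} {τ : ℝ}

/-! Rescale `X` to `[0, 1]` and put `a = ε / (2B)`, so the rate is `a⁻¹ * exp (τ / a)`. The
worst-case expectation is the infimum over `l > 0` of `l * cgf X P l⁻¹ + l * τ` (`klRobust_le_dual`,
`exists_dual_le_klRobust_add`).

Upper bound: since `l * cgf X P l⁻¹` decreases in `l`, rounding `l` up to a grid of step `l₀` costs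
at most `l₀ * τ`, and `l ≥ 1 / τ` is harmless because the dual value is then at least 1. So finitely
many `l ≥ l₀` suffice (`klRobust_le_of_grid`). There `exp (X / l)` lies between 1 and `exp l₀⁻¹`,
and a multiplicative Chernoff bound with a union bound needs about `exp l₀⁻¹` samples, up to
polynomial factors; `l₀ ≈ a / τ` gives the rate.

Lower bound: give the good point mass `p = a * exp (-τ / a)`, the reciprocal of the rate. Tilting
lifts its mass above `a` within the KL ball (`lt_klRobust_twoPoint`), yet `n * p ≤ 1 / 2` leaves it
unseen with probability at least `1 / 2`, so the sample looks as if drawn from a Dirac mass. -/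

lemma integrable_of_mem_Icc (Q : Measure Ω) [IsFiniteMeasure Q] {a b : ℝ} (hX : Measurable X)
    (hb : ∀ ω, X ω ∈ Icc a b) : Integrable X Q :=
  Integrable.of_mem_Icc a b hX.aemeasurable (.of_forall hb)

lemma integrable_exp_mul_of_forall_mem_Icc (Q : Measure Ω) [IsFiniteMeasure Q] {a b : ℝ}
    (hX : Measurable X) (hb : ∀ ω, X ω ∈ Icc a b) (θ : ℝ) :
    Integrable (fun ω ↦ exp (θ * X ω)) Q :=
  integrable_exp_mul_of_mem_Icc hX.aemeasurable (.of_forall hb)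

lemma mem_interior_integrableExpSet_of_mem_Icc (Q : Measure Ω) [IsFiniteMeasure Q] {a b : ℝ}
    (hX : Measurable X) (hb : ∀ ω, X ω ∈ Icc a b) (θ : ℝ) :
    θ ∈ interior (integrableExpSet X Q) := by
  have : integrableExpSet X Q = univ :=
    eq_univ_of_forall fun t ↦ integrable_exp_mul_of_forall_mem_Icc Q hX hb t
  simp [this]

lemma integral_mem_Icc (Q : Measure Ω) [IsProbabilityMeasure Q] (hX : Measurable X) {a b : ℝ}
    (hb : ∀ ω, X ω ∈ Icc a b) : ∫ ω, X ω ∂Q ∈ Icc a b := by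
  have hi := integrable_of_mem_Icc Q hX hb
  constructor
  · simpa using integral_mono (integrable_const a) hi fun ω ↦ (hb ω).1
  · simpa using integral_mono hi (integrable_const b) fun ω ↦ (hb ω).2

lemma integral_le_klRobust (hX : Measurable X) {a b : ℝ} (hb : ∀ ω, X ω ∈ Icc a b)
    {Q : Measure Ω} [IsProbabilityMeasure Q] (hQ : klDiv Q P ≤ ENNReal.ofReal τ) :
    ∫ ω, X ω ∂Q ≤ klRobust P τ X := by
  refine le_csSup ⟨b, ?_⟩ ⟨Q, inferInstance, hQ, rfl⟩
  rintro r ⟨Q', hQ', -, rfl⟩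
  exact (integral_mem_Icc Q' hX hb).2

variable [IsProbabilityMeasure P]

/-- The Donsker-Varadhan inequality on a Kullback-Leibler ball. -/
lemma mul_integral_le_of_klDiv_le (hX : Measurable X) {a b : ℝ} (hb : ∀ ω, X ω ∈ Icc a b)
    (hτ : 0 ≤ τ) {Q : Measure Ω} [IsProbabilityMeasure Q]
    (hQ : klDiv Q P ≤ ENNReal.ofReal τ) (θ : ℝ) :
    θ * ∫ ω, X ω ∂Q ≤ τ + cgf X P θ := by
  obtain ⟨hac, hint⟩ := klDiv_ne_top_iff.mp (ne_top_of_le_ne_top ENNReal.ofReal_ne_top hQ)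
  have he := integrable_exp_mul_of_forall_mem_Icc P hX hb θ
  have hi := (integrable_of_mem_Icc Q hX hb).const_mul θ
  have := isProbabilityMeasure_tilted he
  -- This is `KL(Q ‖ P_θ) ≥ 0` for the tilted measure `P_θ`, expanded into `KL(Q ‖ P)`, the mean of
  -- `X` and the cgf.
  have h1 := integral_llr_add_sub_measure_univ_nonneg
    (hac.trans (absolutelyContinuous_tilted he)) (integrable_llr_tilted_right hac hi hint he)
  rw [integral_llr_tilted_right hac hi he hint, integral_const_mul] at h1
  have h2 := ENNReal.toReal_le_of_le_ofReal hτ hQ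
  rw [toReal_klDiv_of_measure_eq hac (by simp)] at h2
  simp only [probReal_univ] at h1
  simp only [cgf, mgf]
  linarith

lemma integral_llr_tilted_mul (hX : Measurable X) {a b : ℝ} (hb : ∀ ω, X ω ∈ Icc a b) (θ : ℝ) :
    Integrable (llr (P.tilted (θ * X ·)) P) (P.tilted (θ * X ·)) ∧
      ∫ ω, llr (P.tilted (θ * X ·)) P ω ∂(P.tilted (θ * X ·))
        = θ * deriv (cgf X P) θ - cgf X P θ := by
  have he := integrable_exp_mul_of_forall_mem_Icc P hX hb θ
  have := isProbabilityMeasure_tilted he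
  have hllr : llr (P.tilted (θ * X ·)) P =ᵐ[P.tilted (θ * X ·)]
      fun ω ↦ θ * X ω - cgf X P θ := by
    filter_upwards [(tilted_absolutelyContinuous P (θ * X ·)).ae_le
      (log_rnDeriv_tilted_left_self he)] with ω hω
    rw [llr, hω, cgf, mgf]
  have hi := (integrable_of_mem_Icc (P.tilted (θ * X ·)) hX hb).const_mul θ
  refine ⟨(integrable_congr hllr).mpr (hi.sub (integrable_const _)), ?_⟩
  rw [integral_congr_ae hllr, integral_sub hi (integrable_const _), integral_const_mul,
    integral_tilted_mul_self (mem_interior_integrableExpSet_of_mem_Icc P hX hb θ)]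
  simp

lemma klDiv_tilted_mul (hX : Measurable X) {a b : ℝ} (hb : ∀ ω, X ω ∈ Icc a b) (θ : ℝ) :
    klDiv (P.tilted (θ * X ·)) P
      = ENNReal.ofReal (θ * deriv (cgf X P) θ - cgf X P θ) := by
  have := isProbabilityMeasure_tilted (integrable_exp_mul_of_forall_mem_Icc P hX hb θ)
  obtain ⟨hint, heq⟩ := integral_llr_tilted_mul (P := P) hX hb θ
  rw [klDiv_of_ac_of_integrable (tilted_absolutelyContinuous P _) hint, heq]
  simp

/-- The difference of the two sides is the KL divergence of the tilted measure from `P`. -/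
lemma cgf_le_mul_deriv_cgf (hX : Measurable X) {a b : ℝ} (hb : ∀ ω, X ω ∈ Icc a b) (θ : ℝ) :
    cgf X P θ ≤ θ * deriv (cgf X P) θ := by
  have := isProbabilityMeasure_tilted (integrable_exp_mul_of_forall_mem_Icc P hX hb θ)
  obtain ⟨hint, heq⟩ := integral_llr_tilted_mul (P := P) hX hb θ
  have h := integral_llr_add_sub_measure_univ_nonneg (tilted_absolutelyContinuous P _) hint
  rw [heq] at h
  simp only [probReal_univ] at h
  linarith

lemma klRobust_le {c : ℝ} (h : ∀ (Q : Measure Ω) [IsProbabilityMeasure Q],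
    klDiv Q P ≤ ENNReal.ofReal τ → ∫ ω, X ω ∂Q ≤ c) : klRobust P τ X ≤ c := by
  refine csSup_le ⟨_, P, inferInstance, by simp, rfl⟩ ?_
  rintro r ⟨Q, hQ, hle, rfl⟩
  exact h Q hle

lemma klRobust_mem_Icc (hX : Measurable X) {a b : ℝ} (hb : ∀ ω, X ω ∈ Icc a b) :
    klRobust P τ X ∈ Icc a b :=
  ⟨(integral_mem_Icc P hX hb).1.trans (integral_le_klRobust hX hb (by simp)),
    klRobust_le fun Q _ _ ↦ (integral_mem_Icc Q hX hb).2⟩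

lemma klRobust_const_mul_add (hX : Measurable X) {a b : ℝ} (hb : ∀ ω, X ω ∈ Icc a b) {c : ℝ}
    (hc : 0 < c) (d : ℝ) :
    klRobust P τ (fun ω ↦ c * X ω + d) = c * klRobust P τ X + d := by
  have hint (Q : Measure Ω) [IsProbabilityMeasure Q] :
      ∫ ω, (c * X ω + d) ∂Q = c * ∫ ω, X ω ∂Q + d := by
    rw [integral_add ((integrable_of_mem_Icc Q hX hb).const_mul c) (integrable_const _),
      integral_const_mul]
    simp
  have hb' : ∀ ω, c * X ω + d ∈ Icc (c * a + d) (c * b + d) := fun ω ↦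
    ⟨by have := (hb ω).1; gcongr, by have := (hb ω).2; gcongr⟩
  apply le_antisymm
  · refine klRobust_le fun Q _ hQ ↦ ?_
    rw [hint]
    have := integral_le_klRobust hX hb hQ
    gcongr
  · suffices h : klRobust P τ X ≤ (klRobust P τ (fun ω ↦ c * X ω + d) - d) / c by
      rw [le_div_iff₀ hc] at h
      linarith
    refine klRobust_le fun Q _ hQ ↦ ?_
    have := integral_le_klRobust ((hX.const_mul c).add_const d) hb' hQ
    rw [hint] at this
    rw [le_div_iff₀ hc]
    linarith

lemma deriv_cgf_le_klRobust (hX : Measurable X) {a b : ℝ} (hb : ∀ ω, X ω ∈ Icc a b) {θ : ℝ}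
    (hθ : θ * deriv (cgf X P) θ - cgf X P θ ≤ τ) : deriv (cgf X P) θ ≤ klRobust P τ X := by
  have := isProbabilityMeasure_tilted (integrable_exp_mul_of_forall_mem_Icc P hX hb θ)
  rw [← integral_tilted_mul_self (mem_interior_integrableExpSet_of_mem_Icc P hX hb θ)]
  exact integral_le_klRobust hX hb
    ((klDiv_tilted_mul hX hb θ).trans_le (ENNReal.ofReal_le_ofReal hθ))

/-- Weak duality for the worst-case expectation. -/
lemma klRobust_le_dual (hX : Measurable X) {a b : ℝ} (hb : ∀ ω, X ω ∈ Icc a b) (hτ : 0 ≤ τ)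
    {l : ℝ} (hl : 0 < l) : klRobust P τ X ≤ l * cgf X P l⁻¹ + l * τ := by
  refine klRobust_le fun Q _ hQ ↦ ?_
  have h := mul_le_mul_of_nonneg_left (mul_integral_le_of_klDiv_le hX hb hτ hQ l⁻¹) hl.le
  rw [← mul_assoc, mul_inv_cancel₀ hl.ne'] at h
  linarith

lemma continuous_cgf_of_mem_Icc (hX : Measurable X) {a b : ℝ} (hb : ∀ ω, X ω ∈ Icc a b) :
    Continuous (cgf X P) := continuous_iff_continuousAt.mpr fun θ ↦
  (analyticAt_cgf (mem_interior_integrableExpSet_of_mem_Icc P hX hb θ)).continuousAt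

lemma continuous_deriv_cgf_of_mem_Icc (hX : Measurable X) {a b : ℝ}
    (hb : ∀ ω, X ω ∈ Icc a b) :
    Continuous (deriv (cgf X P)) := continuous_iff_continuousAt.mpr fun θ ↦
  (analyticAt_cgf (mem_interior_integrableExpSet_of_mem_Icc P hX hb θ)).deriv.continuousAt

/-- Strong duality for the worst-case expectation. -/
lemma exists_dual_le_klRobust_add (hX : Measurable X) {a b : ℝ} (hb : ∀ ω, X ω ∈ Icc a b)
    (hτ : 0 < τ) {η : ℝ} (hη : 0 < η) :
    ∃ l, 0 < l ∧ l * cgf X P l⁻¹ + l * τ ≤ klRobust P τ X + η := by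
  set K : ℝ → ℝ := fun θ ↦ θ * deriv (cgf X P) θ - cgf X P θ with hK
  have hKc : Continuous K := (continuous_id.mul (continuous_deriv_cgf_of_mem_Icc hX hb)).sub
    (continuous_cgf_of_mem_Icc hX hb)
  have hK0 : K 0 = 0 := by simp [hK]
  -- `K θ` is the divergence of the tilted measure. If it reaches `τ`, that tilt is optimal and `l =
  -- θ⁻¹`. Otherwise every tilt is admissible, and a small `l` works with error `l * τ = η`.
  by_cases h : ∃ θ, 0 ≤ θ ∧ K θ = τ
  · obtain ⟨θ, hθ, hθK⟩ := h
    have hθ0 : 0 < θ := hθ.lt_of_ne (by rintro rfl; linarith)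
    refine ⟨θ⁻¹, inv_pos.mpr hθ0, ?_⟩
    have h1 : deriv (cgf X P) θ ≤ klRobust P τ X := deriv_cgf_le_klRobust hX hb hθK.le
    have h2 : cgf X P θ + τ = θ * deriv (cgf X P) θ := by
      rw [← hθK]
      ring
    rw [inv_inv, ← mul_add, h2, ← mul_assoc, inv_mul_cancel₀ hθ0.ne']
    linarith
  · have hlt : ∀ θ, 0 ≤ θ → K θ < τ := by
      intro θ hθ
      by_contra! hge
      obtain ⟨t, ht, htK⟩ := intermediate_value_Icc hθ hKc.continuousOn
        (show τ ∈ Icc (K 0) (K θ) from ⟨by linarith, hge⟩)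
      exact h ⟨t, ht.1, htK⟩
    have hl : 0 < η / τ := by positivity
    refine ⟨η / τ, hl, ?_⟩
    set l := η / τ with hl_def
    have hi : 0 < l⁻¹ := inv_pos.mpr hl
    have h1 : deriv (cgf X P) l⁻¹ ≤ klRobust P τ X :=
      deriv_cgf_le_klRobust hX hb (hlt _ hi.le).le
    have h2 : 0 ≤ K l⁻¹ := sub_nonneg.mpr (cgf_le_mul_deriv_cgf hX hb l⁻¹)
    have h3 : l * K l⁻¹ = deriv (cgf X P) l⁻¹ - l * cgf X P l⁻¹ := by
      simp only [hK, mul_sub]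
      rw [← mul_assoc, mul_inv_cancel₀ hl.ne', one_mul]
    have h4 := mul_nonneg hl.le h2
    have h5 : l * τ = η := by rw [hl_def]; field_simp
    linarith

/-- Lyapunov's inequality for the cumulant generating function. -/
lemma mul_cgf_inv_antitone (hX : Measurable X) {a b : ℝ} (hb : ∀ ω, X ω ∈ Icc a b)
    {l m : ℝ} (hl : 0 < l) (hlm : l ≤ m) : m * cgf X P m⁻¹ ≤ l * cgf X P l⁻¹ := by
  have hm := hl.trans_le hlm
  have hr : 1 ≤ m / l := (one_le_div hl).mpr hlm
  have hpow : ∀ ω, exp (m⁻¹ * X ω) ^ (m / l) = exp (l⁻¹ * X ω) := by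
    intro ω
    rw [← exp_mul]
    congr 1
    field_simp
  -- Jensen for `x ↦ x ^ (m / l)`, applied to `exp (X / m)`.
  have hj := (convexOn_rpow hr).map_integral_le (μ := P) (f := fun ω ↦ exp (m⁻¹ * X ω))
    (continuousOn_id.rpow_const fun _ _ ↦ Or.inr (by positivity)) isClosed_Ici
    (.of_forall fun ω ↦ (exp_pos _).le) (integrable_exp_mul_of_forall_mem_Icc P hX hb _)
    (by
      simp only [Function.comp_def, hpow]
      exact integrable_exp_mul_of_forall_mem_Icc P hX hb _)
  simp only [hpow] at hj
  have hpos : 0 < mgf X P m⁻¹ := mgf_pos (integrable_exp_mul_of_forall_mem_Icc P hX hb _)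
  have h := log_le_log (rpow_pos_of_pos hpos _) hj
  rw [log_rpow hpos] at h
  have h' := mul_le_mul_of_nonneg_left h hl.le
  rw [← mul_assoc, mul_div_cancel₀ _ hl.ne'] at h'
  exact h'

end Duality

/-! ### Discretizing the dual problem. -/

section Grid

open ProbabilityTheory InformationTheory Real Set

variable {Ω : Type*} [MeasurableSpace Ω] {X : Ω → ℝ} {τ : ℝ}

/-- If the dual functions of `μ` and `ν` are close on a finite grid of step `l₀`, then so are the
worst-case expectations. -/
lemma klRobust_le_of_grid {μ ν : Measure Ω} [IsProbabilityMeasure μ] [IsProbabilityMeasure ν]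
    (hX : Measurable X) (hb : ∀ ω, X ω ∈ Icc 0 1) (hτ : 0 < τ) {l₀ ξ : ℝ} (hl₀ : 0 < l₀)
    (hξ : 0 ≤ ξ) {N : ℕ} (hN : 1 ≤ N * l₀ * τ)
    (hgrid : ∀ j ∈ Finset.Icc 1 N, (j * l₀) * cgf X ν (j * l₀)⁻¹
      ≤ (j * l₀) * cgf X μ (j * l₀)⁻¹ + ξ) :
    klRobust ν τ X ≤ klRobust μ τ X + l₀ * τ + ξ := by
  refine le_of_forall_pos_le_add fun η hη ↦ ?_
  obtain ⟨l, hl, hle⟩ := exists_dual_le_klRobust_add (P := μ) hX hb hτ hη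
  have hlτ := mul_pos hl₀ hτ
  -- A near-optimal `l` for `μ` inside the grid range is rounded up. Beyond it, `l * τ ≥ 1` already
  -- dominates any worst-case value of `X ≤ 1`.
  rcases le_or_gt l (N * l₀) with hlN | hlN
  · set j := ⌈l / l₀⌉₊ with hj
    have hj1 : 0 < j := Nat.ceil_pos.mpr (by positivity)
    have hjN : j ≤ N := Nat.ceil_le.mpr ((div_le_iff₀ hl₀).mpr hlN)
    have hjl : l ≤ j * l₀ := (div_le_iff₀ hl₀).mp (Nat.le_ceil _)
    have hjl' : j * l₀ ≤ l + l₀ := by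
      have := (Nat.ceil_lt_add_one (div_pos hl hl₀).le).le
      rw [← hj, ← div_self hl₀.ne', ← add_div, le_div_iff₀ hl₀] at this
      exact this
    have h1 := klRobust_le_dual (P := ν) hX hb hτ.le (l := j * l₀) (by positivity)
    have h2 := hgrid j (Finset.mem_Icc.mpr ⟨hj1, hjN⟩)
    have h3 := mul_cgf_inv_antitone (P := μ) hX hb hl hjl
    have h4 := mul_le_mul_of_nonneg_right hjl' hτ.le
    linarith
  · have h1 : klRobust ν τ X ≤ 1 := (klRobust_mem_Icc hX hb).2
    have h2 : 0 ≤ cgf X μ l⁻¹ := by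
      refine log_nonneg ?_
      have := integral_mono (integrable_const (μ := μ) 1)
        (integrable_exp_mul_of_forall_mem_Icc μ hX hb l⁻¹)
        fun ω ↦ one_le_exp (mul_nonneg (inv_nonneg.mpr hl.le) (hb ω).1)
      simpa [mgf] using this
    have h3 := mul_nonneg hl.le h2
    have h4 := mul_le_mul_of_nonneg_right hlN.le hτ.le
    linarith

end Grid

/-! ### Multiplicative Chernoff bounds for sums of `[0, 1]`-valued variables. -/

section Chernoff

open ProbabilityTheory InformationTheory Real Set

lemma half_sq_le_mul_exp_sub {h : ℝ} (hh : 0 ≤ h) : h ^ 2 / 2 ≤ h * exp h - exp h + 1 := by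
  have hmono : MonotoneOn (fun x : ℝ ↦ x * exp x - exp x + 1 - x ^ 2 / 2) (Ici 0) := by
    have hd (x : ℝ) : HasDerivAt (fun x : ℝ ↦ x * exp x - exp x + 1 - x ^ 2 / 2)
        (x * exp x - x) x := by
      have := ((((hasDerivAt_id x).mul (hasDerivAt_exp x)).sub (hasDerivAt_exp x)).add_const
        (1 : ℝ)).sub (((hasDerivAt_id x).pow 2).div_const 2)
      refine this.congr_deriv ?_
      simp only [id, Nat.cast_ofNat]
      ring
    refine monotoneOn_of_deriv_nonneg (convex_Ici 0)
      (fun x _ ↦ (hd x).continuousAt.continuousWithinAt)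
      (fun x _ ↦ (hd x).differentiableAt.differentiableWithinAt) fun x hx ↦ ?_
    rw [interior_Ici, mem_Ioi] at hx
    rw [(hd x).deriv]
    nlinarith [one_le_exp hx.le]
  have := hmono (mem_Ici.mpr le_rfl) (mem_Ici.mpr hh) hh
  simp at this
  linarith

lemma exp_neg_mul_half_sq_le {h : ℝ} (hh : 0 ≤ h) :
    exp (-h) * (h ^ 2 / 2) ≤ 1 - exp (-h) - h * exp (-h) := by
  have h1 := mul_le_mul_of_nonneg_left (quadratic_le_exp_of_nonneg hh) (exp_pos (-h)).le
  rw [← exp_add, neg_add_cancel, exp_zero] at h1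
  linarith

variable {Ω : Type*} [MeasurableSpace Ω] {P : Measure Ω} [IsProbabilityMeasure P]
  {g : Ω → ℝ} {n : ℕ}

lemma mgf_sum_pi_le (hg : Measurable g) (hb : ∀ ω, g ω ∈ Icc 0 1) (t : ℝ) :
    mgf (fun s : Fin n → Ω ↦ ∑ i, g (s i)) (Measure.pi fun _ ↦ P) t
      ≤ exp (n * ((∫ ω, g ω ∂P) * (exp t - 1))) := by
  have h1 : ∫ ω, exp (t * g ω) ∂P ≤ exp ((∫ ω, g ω ∂P) * (exp t - 1)) := by
    have hi := integrable_of_mem_Icc P hg hb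
    -- The chord of `exp` over `[0, t]`: Bernoulli variables are the worst case.
    have hpt : ∀ ω, exp (t * g ω) ≤ 1 + g ω * (exp t - 1) := by
      intro ω
      have := convexOn_exp.2 (mem_univ 0) (mem_univ t) (sub_nonneg.mpr (hb ω).2) (hb ω).1
        (by ring)
      simp only [smul_eq_mul, mul_zero, zero_add, exp_zero, mul_one] at this
      rw [mul_comm t]
      linarith
    calc ∫ ω, exp (t * g ω) ∂P ≤ ∫ ω, (1 + g ω * (exp t - 1)) ∂P :=
          integral_mono (integrable_exp_mul_of_forall_mem_Icc P hg hb t)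
            ((integrable_const _).add (hi.mul_const _)) hpt
      _ = (∫ ω, g ω ∂P) * (exp t - 1) + 1 := by
          rw [integral_add (integrable_const _) (hi.mul_const _), integral_mul_const]
          simp [add_comm]
      _ ≤ _ := add_one_le_exp _
  have h2 : mgf (fun s : Fin n → Ω ↦ ∑ i, g (s i)) (Measure.pi fun _ ↦ P) t
      = (∫ ω, exp (t * g ω) ∂P) ^ n := by
    simp only [mgf, Finset.mul_sum, exp_sum]
    rw [integral_fintype_prod_eq_pow (fun ω ↦ exp (t * g ω)), Fintype.card_fin]
  rw [h2, exp_nat_mul]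
  exact pow_le_pow_left₀ (integral_nonneg fun ω ↦ (exp_pos _).le) h1 n

lemma integrable_exp_mul_sum_pi (hg : Measurable g) (hb : ∀ ω, g ω ∈ Icc 0 1) (t : ℝ) :
    Integrable (fun s : Fin n → Ω ↦ exp (t * ∑ i, g (s i))) (Measure.pi fun _ ↦ P) := by
  refine integrable_exp_mul_of_forall_mem_Icc (a := 0) (b := n) _
    (X := fun s : Fin n → Ω ↦ ∑ i, g (s i)) (by fun_prop) (fun s ↦ ⟨?_, ?_⟩) t
  · exact Finset.sum_nonneg fun i _ ↦ (hb _).1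
  · simpa using Finset.sum_le_sum (s := Finset.univ) fun i _ ↦ (hb (s i)).2

/-- Multiplicative Chernoff bound, upper tail. -/
lemma measure_exp_mul_le_sum_pi_le (hg : Measurable g) (hb : ∀ ω, g ω ∈ Icc 0 1) {h : ℝ}
    (hh : 0 ≤ h) :
    (Measure.pi fun _ : Fin n ↦ P).real {s | n * (exp h * ∫ ω, g ω ∂P) ≤ ∑ i, g (s i)}
      ≤ exp (-(n * (∫ ω, g ω ∂P) * (exp (-h) * (h ^ 2 / 2)))) := by
  have hm : 0 ≤ ∫ ω, g ω ∂P := integral_nonneg fun ω ↦ (hb ω).1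
  refine (measure_ge_le_exp_mul_mgf _ hh (integrable_exp_mul_sum_pi hg hb h)).trans ?_
  refine (mul_le_mul_of_nonneg_left (mgf_sum_pi_le hg hb h) (exp_pos _).le).trans ?_
  rw [← exp_add, exp_le_exp]
  have h1 : exp (-h) * (h ^ 2 / 2) ≤ h * exp h - exp h + 1 :=
    (mul_le_of_le_one_left (by positivity) (exp_le_one_iff.mpr (by linarith))).trans
      (half_sq_le_mul_exp_sub hh)
  have h2 := mul_le_mul_of_nonneg_left h1 (mul_nonneg n.cast_nonneg hm)
  linarith

/-- Multiplicative Chernoff bound, lower tail. -/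
lemma measure_sum_pi_le_exp_neg_mul_le (hg : Measurable g) (hb : ∀ ω, g ω ∈ Icc 0 1) {h : ℝ}
    (hh : 0 ≤ h) :
    (Measure.pi fun _ : Fin n ↦ P).real {s | ∑ i, g (s i) ≤ n * (exp (-h) * ∫ ω, g ω ∂P)}
      ≤ exp (-(n * (∫ ω, g ω ∂P) * (exp (-h) * (h ^ 2 / 2)))) := by
  have hm : 0 ≤ ∫ ω, g ω ∂P := integral_nonneg fun ω ↦ (hb ω).1
  refine (measure_le_le_exp_mul_mgf _ (neg_nonpos.mpr hh)
    (integrable_exp_mul_sum_pi hg hb (-h))).trans ?_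
  refine (mul_le_mul_of_nonneg_left (mgf_sum_pi_le hg hb (-h)) (exp_pos _).le).trans ?_
  rw [← exp_add, exp_le_exp]
  have h2 := mul_le_mul_of_nonneg_left (exp_neg_mul_half_sq_le hh)
    (mul_nonneg n.cast_nonneg hm)
  linarith

end Chernoff

/-! ### The empirical distribution. -/

section Empirical

open ProbabilityTheory InformationTheory Real Set

variable {Ω : Type*} [MeasurableSpace Ω] {n : ℕ}

lemma isProbabilityMeasure_empiricalDistribution (hn : 0 < n) (s : Fin n → Ω) :
    IsProbabilityMeasure (empiricalDistribution s) := by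
  constructor
  simp only [empiricalDistribution, Measure.smul_apply, Measure.coe_finsetSum,
    Finset.sum_apply, measure_univ, Finset.sum_const, Finset.card_univ, Fintype.card_fin,
    nsmul_eq_mul, mul_one, smul_eq_mul]
  exact ENNReal.inv_mul_cancel (by simpa using hn.ne') (by simp)

lemma integral_empiricalDistribution (s : Fin n → Ω) {g : Ω → ℝ} (hg : Measurable g) :
    ∫ ω, g ω ∂(empiricalDistribution s) = (n : ℝ)⁻¹ * ∑ i, g (s i) := by
  rw [empiricalDistribution, integral_smul_measure, integral_finsetSum_measure]
  · simp [integral_dirac' _ _ hg.stronglyMeasurable]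
  · exact fun i _ ↦ integrable_dirac' hg.stronglyMeasurable (by simp)

end Empirical

/-! ### The two-point construction for the lower bounds. -/

section TwoPoint

open ProbabilityTheory InformationTheory Real Set

/-- The probability measure on `Bool` giving mass `p` to `true`. -/
noncomputable def twoPoint (p : ℝ) : Measure Bool :=
  ENNReal.ofReal p • Measure.dirac true + ENNReal.ofReal (1 - p) • Measure.dirac false

variable {p : ℝ}

lemma isProbabilityMeasure_twoPoint (h0 : 0 ≤ p) (h1 : p ≤ 1) :
    IsProbabilityMeasure (twoPoint p) := by
  constructor
  simp only [twoPoint, Measure.add_apply, Measure.smul_apply, measure_univ, smul_eq_mul, mul_one]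
  rw [← ENNReal.ofReal_add h0 (by linarith)]
  simp

lemma twoPoint_singleton_false : twoPoint p {false} = ENNReal.ofReal (1 - p) := by
  simp [twoPoint]

lemma integral_twoPoint (h0 : 0 ≤ p) (h1 : p ≤ 1) (g : Bool → ℝ) :
    ∫ b, g b ∂(twoPoint p) = p * g true + (1 - p) * g false := by
  have hi (b : Bool) : Integrable g (Measure.dirac b) :=
    integrable_dirac (by simp)
  rw [twoPoint, integral_add_measure ((hi _).smul_measure ENNReal.ofReal_ne_top)
    ((hi _).smul_measure ENNReal.ofReal_ne_top), integral_smul_measure, integral_smul_measure]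
  simp [ENNReal.toReal_ofReal h0, ENNReal.toReal_ofReal (sub_nonneg.mpr h1)]

lemma lt_klRobust_twoPoint {τ a : ℝ} (hτ : 0 < τ) (ha : 0 < a) (ha1 : a < 1) :
    a < klRobust (twoPoint (a * exp (-τ / a))) τ (fun b ↦ if b then 1 else 0) := by
  set p := a * exp (-τ / a) with hp
  set Y : Bool → ℝ := fun b ↦ if b then 1 else 0 with hY
  have hp0 : 0 < p := by positivity
  have hpa : p < a := mul_lt_of_lt_one_right ha
    (exp_lt_one_iff.mpr (div_neg_of_neg_of_pos (neg_neg_of_pos hτ) ha))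
  have := isProbabilityMeasure_twoPoint hp0.le (hpa.trans ha1).le
  have hYm : Measurable Y := measurable_of_finite _
  have hYb : ∀ b, Y b ∈ Icc (0 : ℝ) 1 := by simp [hY]
  have hmgf (θ : ℝ) : mgf Y (twoPoint p) θ = p * exp θ + (1 - p) := by
    rw [mgf, integral_twoPoint hp0.le (hpa.trans ha1).le]
    simp [hY]
  have hderiv (θ : ℝ) : deriv (cgf Y (twoPoint p)) θ = p * exp θ / (p * exp θ + (1 - p)) := by
    rw [deriv_cgf (mem_interior_integrableExpSet_of_mem_Icc _ hYm hYb θ), hmgf,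
      integral_twoPoint hp0.le (hpa.trans ha1).le]
    simp [hY]
  -- At `θ = τ / a + s` the tilt gives `true` mass exactly `a`, at divergence `τ - (1 - a) * s < τ`.
  -- The slack allows a slightly larger `θ`, which makes the inequality strict.
  set s := log ((1 - p) / (1 - a)) with hs
  have hs0 : 0 < s := log_pos ((one_lt_div (by linarith)).mpr (by linarith))
  have hexp : p * exp (τ / a + s) = a * ((1 - p) / (1 - a)) := by
    rw [exp_add, hs, exp_log (div_pos (by linarith) (by linarith)), hp, neg_div, exp_neg]
    field_simp
  have hsum : p * exp (τ / a + s) + (1 - p) = (1 - p) / (1 - a) := by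
    rw [hexp]
    have : 1 - a ≠ 0 := by linarith
    field_simp
    ring
  have hK : (τ / a + s) * deriv (cgf Y (twoPoint p)) (τ / a + s)
      - cgf Y (twoPoint p) (τ / a + s) < τ := by
    have hd : deriv (cgf Y (twoPoint p)) (τ / a + s) = a := by
      rw [hderiv, hsum, hexp, mul_div_cancel_right₀]
      exact (div_pos (by linarith) (by linarith)).ne'
    rw [hd, cgf, hmgf, hsum, ← hs, add_mul, div_mul_cancel₀ _ ha.ne']
    nlinarith
  have hcont : Continuous fun θ ↦ θ * deriv (cgf Y (twoPoint p)) θ - cgf Y (twoPoint p) θ :=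
    (continuous_id.mul (continuous_deriv_cgf_of_mem_Icc hYm hYb)).sub
      (continuous_cgf_of_mem_Icc hYm hYb)
  obtain ⟨θ, hθK, hθ⟩ := (((hcont.tendsto (τ / a + s)).eventually_lt_const hK).filter_mono
    (nhdsWithin_le_nhds (s := Ioi (τ / a + s))) |>.and self_mem_nhdsWithin).exists
  refine lt_of_lt_of_le ?_ (deriv_cgf_le_klRobust hYm hYb hθK.le)
  have hlt : a * ((1 - p) / (1 - a)) < p * exp θ := by
    rw [← hexp]
    exact mul_lt_mul_of_pos_left (exp_lt_exp.mpr hθ) hp0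
  rw [← mul_div_assoc, div_lt_iff₀ (by linarith)] at hlt
  rw [hderiv, lt_div_iff₀ (by nlinarith [exp_pos θ])]
  linarith

/-- Finite divergence forces absolute continuity, so `X` is `Q`-a.e. equal to `X x`. -/
lemma klRobust_dirac {Ω : Type*} [MeasurableSpace Ω] [MeasurableSingletonClass Ω] (x : Ω) (τ : ℝ)
    (X : Ω → ℝ) : klRobust (Measure.dirac x) τ X = X x := by
  have hval (Q : Measure Ω) [IsProbabilityMeasure Q]
      (hQ : klDiv Q (Measure.dirac x) ≤ ENNReal.ofReal τ) : ∫ ω, X ω ∂Q = X x := by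
    have hac := (klDiv_ne_top_iff.mp (ne_top_of_le_ne_top ENNReal.ofReal_ne_top hQ)).1
    have hae : X =ᵐ[Q] fun _ ↦ X x := hac.ae_le (by simp [ae_dirac_eq])
    rw [integral_congr_ae hae]
    simp
  have hset : {r : ℝ | ∃ Q : Measure Ω, IsProbabilityMeasure Q ∧
      klDiv Q (Measure.dirac x) ≤ ENNReal.ofReal τ ∧ r = ∫ ω, X ω ∂Q} = {X x} := by
    ext r
    constructor
    · rintro ⟨Q, hQ, hle, rfl⟩
      exact hval Q hle
    · rintro rfl
      exact ⟨Measure.dirac x, inferInstance, by simp, by simp⟩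
  rw [klRobust, hset, csSup_singleton]

lemma empiricalDistribution_const {Ω : Type*} [MeasurableSpace Ω] {n : ℕ} (hn : 0 < n) (x : Ω) :
    empiricalDistribution (fun _ : Fin n ↦ x) = Measure.dirac x := by
  rw [empiricalDistribution, Finset.sum_const, Finset.card_univ, Fintype.card_fin,
    ← Nat.cast_smul_eq_nsmul ENNReal, smul_smul,
    ENNReal.inv_mul_cancel (by simpa using hn.ne') (by simp), one_smul]

/-- The all-`false` sample alone has mass `(1 - p) ^ n ≥ 1 - n * p`, by Bernoulli's inequality. -/
lemma half_le_pi_twoPoint_of_mem {n : ℕ} (h0 : 0 ≤ p) (h1 : p ≤ 1) (hnp : n * p ≤ 1 / 2)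
    {S : Set (Fin n → Bool)} (hS : (fun _ ↦ false) ∈ S) :
    1 / 2 ≤ Measure.pi (fun _ : Fin n ↦ twoPoint p) S := by
  have := isProbabilityMeasure_twoPoint h0 h1
  refine le_trans ?_ (measure_mono (singleton_subset_iff.mpr hS))
  rw [Measure.pi_singleton]
  simp only [twoPoint_singleton_false, Finset.prod_const, Finset.card_univ, Fintype.card_fin]
  rw [← ENNReal.ofReal_pow (by linarith), show (1 / 2 : ENNReal) = ENNReal.ofReal (1 / 2) by
    rw [ENNReal.ofReal_div_of_pos two_pos]; simp]
  refine ENNReal.ofReal_le_ofReal ?_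
  have := one_add_mul_le_pow (a := -p) (by linarith) n
  rw [← sub_eq_add_neg] at this
  linarith

/-- A sample of size at most `klRate B τ ε / 2` cannot distinguish a constant random variable from
one with a substantially larger worst-case expectation. -/
theorem exists_twoPoint_klRobust {τ B ε : ℝ} (hτ : 0 < τ) (hε : 0 < ε) (hεB : ε ≤ B) {n : ℕ}
    (hn : (n : ℝ) ≤ klRate B τ ε / 2) :
    ∃ p : ℝ, 0 ≤ p ∧ p ≤ 1 ∧ n * p ≤ 1 / 2 ∧
      -B + ε < klRobust (twoPoint p) τ (fun b ↦ if b then B else -B) := by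
  have hB : 0 < B := hε.trans_le hεB
  set a := ε / (2 * B) with ha
  have ha0 : 0 < a := by positivity
  have ha1 : a < 1 := (div_lt_one (by positivity)).mpr (by linarith)
  have hp1 : a * exp (-τ / a) ≤ 1 := mul_le_one₀ ha1.le (exp_pos _).le
    (exp_le_one_iff.mpr (div_nonpos_of_nonpos_of_nonneg (by linarith) ha0.le))
  have hp0 : 0 ≤ a * exp (-τ / a) := by positivity
  refine ⟨a * exp (-τ / a), hp0, hp1, ?_, ?_⟩
  · have hrate : klRate B τ ε * (a * exp (-τ / a)) = 1 := by
      have h1 : 2 * B * τ / ε = τ / a := by rw [ha]; field_simp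
      rw [klRate, h1, neg_div, exp_neg, ha]
      field_simp
    have := mul_le_mul_of_nonneg_right hn hp0
    linarith
  · have := isProbabilityMeasure_twoPoint hp0 hp1
    have hX : (fun b : Bool ↦ if b then B else -B)
        = fun b ↦ 2 * B * (if b then 1 else 0) + -B := by
      ext b
      cases b
      · simp
      · simp
        ring
    rw [hX, klRobust_const_mul_add (X := fun b : Bool ↦ if b then (1 : ℝ) else 0) (a := 0) (b := 1)
      (measurable_of_finite _) (by simp) (by positivity)]
    have h := mul_lt_mul_of_pos_left (lt_klRobust_twoPoint hτ ha0 ha1)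
      (show 0 < 2 * B by positivity)
    have h2 : 2 * B * a = ε := by rw [ha]; field_simp
    linarith

end TwoPoint

/-! ### Concentration of the sample average approximation. -/

section Concentration

open ProbabilityTheory InformationTheory Real Set

variable {Ω : Type*} [MeasurableSpace Ω] {P : Measure Ω} [IsProbabilityMeasure P]
  {X : Ω → ℝ} {τ : ℝ} {n : ℕ}

lemma measure_lt_abs_cgf_sub_le (hn : 0 < n) (hX : Measurable X) (hb : ∀ ω, X ω ∈ Icc 0 1)
    {θ θ₀ h : ℝ} (hθ : 0 ≤ θ) (hθ₀ : θ ≤ θ₀) (hh : 0 ≤ h) :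
    (Measure.pi fun _ : Fin n ↦ P)
        {s | h < |cgf X (empiricalDistribution s) θ - cgf X P θ|}
      ≤ ENNReal.ofReal (2 * exp (-(n * exp (-θ₀) * (exp (-h) * (h ^ 2 / 2))))) := by
  -- The factor `exp (-θ₀)` brings the values into `[0, 1]` and cancels in relative errors. The mean
  -- of `g` stays at least `exp (-θ₀)` since `X ≥ 0`; this is where the exponential rate enters.
  set g : Ω → ℝ := fun ω ↦ exp (θ * X ω) * exp (-θ₀) with hg_def
  have hn' : (0 : ℝ) < n := by exact_mod_cast hn
  have hexp : Measurable fun ω ↦ exp (θ * X ω) := by fun_prop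
  have hg : Measurable g := hexp.mul_const _
  have hgb : ∀ ω, g ω ∈ Icc 0 1 := by
    intro ω
    refine ⟨by positivity, ?_⟩
    change exp (θ * X ω) * exp (-θ₀) ≤ 1
    rw [← exp_add, exp_le_one_iff]
    nlinarith [(hb ω).2]
  have hgint : ∫ ω, g ω ∂P = mgf X P θ * exp (-θ₀) := integral_mul_const _ _
  have hmgf : 1 ≤ mgf X P θ := by
    have := integral_mono (integrable_const (μ := P) 1)
      (integrable_exp_mul_of_forall_mem_Icc P hX hb θ)
      fun ω ↦ one_le_exp (mul_nonneg hθ (hb ω).1)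
    simpa [mgf] using this
  have hsum (s : Fin n → Ω) :
      ∑ i, g (s i) = n * (mgf X (empiricalDistribution s) θ * exp (-θ₀)) := by
    rw [mgf, integral_empiricalDistribution s hexp, ← Finset.sum_mul]
    field_simp
  have hsub : {s : Fin n → Ω | h < |cgf X (empiricalDistribution s) θ - cgf X P θ|}
      ⊆ {s | n * (exp h * ∫ ω, g ω ∂P) ≤ ∑ i, g (s i)}
        ∪ {s | ∑ i, g (s i) ≤ n * (exp (-h) * ∫ ω, g ω ∂P)} := by
    intro s hs
    by_contra hcon
    simp only [mem_union, mem_ofPred_eq, not_or, not_le] at hcon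
    obtain ⟨h1, h2⟩ := hcon
    rw [hsum, hgint, ← mul_assoc (exp _)] at h1 h2
    have h1' := lt_of_mul_lt_mul_right (lt_of_mul_lt_mul_left h1 hn'.le) (exp_pos _).le
    have h2' := lt_of_mul_lt_mul_right (lt_of_mul_lt_mul_left h2 hn'.le) (exp_pos _).le
    have hpos : 0 < mgf X P θ := by linarith
    have hpos' : 0 < mgf X (empiricalDistribution s) θ :=
      (mul_pos (exp_pos _) hpos).trans h2'
    have l1 := log_lt_log hpos' h1'
    have l2 := log_lt_log (mul_pos (exp_pos _) hpos) h2'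
    rw [log_mul (exp_pos _).ne' hpos.ne', log_exp] at l1 l2
    rw [mem_ofPred_eq] at hs
    refine hs.not_ge (abs_le.mpr ⟨?_, ?_⟩) <;> simp only [cgf] <;> linarith
  have hrate : exp (-(n * (∫ ω, g ω ∂P) * (exp (-h) * (h ^ 2 / 2))))
      ≤ exp (-(n * exp (-θ₀) * (exp (-h) * (h ^ 2 / 2)))) := by
    rw [hgint]
    have : exp (-θ₀) ≤ mgf X P θ * exp (-θ₀) := le_mul_of_one_le_left (exp_pos _).le hmgf
    gcongr
  refine (measure_mono hsub).trans ?_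
  rw [← ofReal_measureReal]
  refine ENNReal.ofReal_le_ofReal ((measureReal_union_le _ _).trans ?_)
  have h1 := measure_exp_mul_le_sum_pi_le (P := P) (n := n) hg hgb hh
  have h2 := measure_sum_pi_le_exp_neg_mul_le (P := P) (n := n) hg hgb hh
  linarith

lemma measure_lt_abs_klRobust_sub_klSAA_le_of_grid (hn : 0 < n) (hX : Measurable X)
    (hb : ∀ ω, X ω ∈ Icc 0 1) (hτ : 0 < τ) {l₀ h : ℝ} (hl₀ : 0 < l₀) (hh : 0 ≤ h) {N : ℕ}
    (hN : 1 ≤ N * l₀ * τ) :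
    (Measure.pi fun _ : Fin n ↦ P)
        {s | l₀ * τ + N * l₀ * h < |klRobust P τ X - klSAA τ X s|}
      ≤ ENNReal.ofReal (N * (2 * exp (-(n * exp (-l₀⁻¹) * (exp (-h) * (h ^ 2 / 2)))))) := by
  have hsub : {s : Fin n → Ω | l₀ * τ + N * l₀ * h < |klRobust P τ X - klSAA τ X s|}
      ⊆ ⋃ j ∈ Finset.Icc 1 N,
        {s | h < |cgf X (empiricalDistribution s) (j * l₀)⁻¹ - cgf X P (j * l₀)⁻¹|} := by
    intro s hs
    by_contra hcon
    simp only [mem_iUnion, mem_ofPred_eq, not_exists, not_lt] at hcon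
    have := isProbabilityMeasure_empiricalDistribution hn s
    have hξ : 0 ≤ N * l₀ * h := by positivity
    have hgrid : ∀ j ∈ Finset.Icc 1 N,
        j * l₀ * cgf X (empiricalDistribution s) (j * l₀)⁻¹
            ≤ j * l₀ * cgf X P (j * l₀)⁻¹ + N * l₀ * h ∧
          j * l₀ * cgf X P (j * l₀)⁻¹
            ≤ j * l₀ * cgf X (empiricalDistribution s) (j * l₀)⁻¹ + N * l₀ * h := by
      intro j hj
      obtain ⟨h1, h2⟩ := abs_le.mp (hcon j hj)
      have hjN : (j : ℝ) * l₀ * h ≤ N * l₀ * h := by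
        have : (j : ℝ) ≤ N := by exact_mod_cast (Finset.mem_Icc.mp hj).2
        gcongr
      have hj0 : 0 ≤ (j : ℝ) * l₀ := by positivity
      constructor <;> nlinarith
    have h1 := klRobust_le_of_grid hX hb hτ hl₀ hξ hN fun j hj ↦ (hgrid j hj).1
    have h2 := klRobust_le_of_grid hX hb hτ hl₀ hξ hN fun j hj ↦ (hgrid j hj).2
    rw [mem_ofPred_eq] at hs
    refine hs.not_ge (abs_le.mpr ⟨?_, ?_⟩) <;> rw [klSAA] <;> linarith
  refine (measure_mono hsub).trans ((measure_biUnion_finset_le _ _).trans ?_)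
  refine (Finset.sum_le_sum fun j hj ↦ measure_lt_abs_cgf_sub_le (θ₀ := l₀⁻¹) hn hX hb
    (by positivity) ?_ hh).trans ?_
  · have : (1 : ℝ) ≤ j := by exact_mod_cast (Finset.mem_Icc.mp hj).1
    exact inv_anti₀ hl₀ (le_mul_of_one_le_left hl₀.le this)
  · rw [Finset.sum_const, Nat.card_Icc, Nat.add_sub_cancel, nsmul_eq_mul,
      ENNReal.ofReal_mul N.cast_nonneg, ENNReal.ofReal_natCast]

/-- The sample average approximation is accurate for random variables with values in `[0, 1]`. -/
theorem measure_lt_abs_klRobust_sub_klSAA_le (hX : Measurable X) (hb : ∀ ω, X ω ∈ Icc 0 1)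
    (hτ : 0 < τ) {a δ : ℝ} (ha : 0 < a) (ha2 : a ≤ 1 / 2) (hδ : 0 < δ) (hδ1 : δ < 1)
    (hn : 48 * exp (3 * τ) / τ ^ 6 * (a⁻¹ * exp (τ / a)) * (τ / a) ^ 4 * log (2 / δ) ≤ n) :
    (Measure.pi fun _ : Fin n ↦ P) {s | a < |klRobust P τ X - klSAA τ X s|}
      ≤ ENNReal.ofReal δ := by
  have hlog : 1 / 2 ≤ log (2 / δ) := by
    have h1 : log 2 ≤ log (2 / δ) :=
      log_le_log two_pos ((le_div_iff₀ hδ).mpr (by linarith))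
    linarith [log_two_gt_d9]
  have hn0 : 0 < n := by
    have : (0 : ℝ) < n := lt_of_lt_of_le (by positivity) hn
    exact_mod_cast this
  -- Rounding may use nearly all of `a`: the `a ^ 2` left over for sampling error changes `l₀⁻¹`
  -- from `τ / a` by at most `2 * τ`, hence `exp l₀⁻¹` only by a constant factor.
  set l₀ := (a - a ^ 2) / τ with hl₀_def
  have haa : a / 2 ≤ a - a ^ 2 := by nlinarith
  have hl₀ : 0 < l₀ := div_pos (by linarith) hτ
  have hl₀τ : l₀ * τ = a - a ^ 2 := div_mul_cancel₀ _ hτ.ne'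
  set N := ⌈1 / (l₀ * τ)⌉₊ with hN_def
  have hN : 1 ≤ N * l₀ * τ := by
    have := Nat.le_ceil (1 / (l₀ * τ))
    rw [div_le_iff₀ (by positivity)] at this
    linarith
  have hNlt : (N : ℝ) * (l₀ * τ) ≤ 1 + l₀ * τ := by
    have := (Nat.ceil_lt_add_one (show 0 ≤ 1 / (l₀ * τ) by positivity)).le
    have := mul_le_mul_of_nonneg_right this (mul_pos hl₀ hτ).le
    rwa [add_mul, one_mul, div_mul_cancel₀ _ (mul_pos hl₀ hτ).ne'] at this
  have hN0 : (0 : ℝ) < N := by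
    have : 0 < N := Nat.ceil_pos.mpr (by positivity)
    exact_mod_cast this
  have hNa : N * a ≤ 3 := by nlinarith
  -- As `N * l₀ * τ ≤ 2`, this makes the sampling error `N * l₀ * h` at most `a ^ 2`.
  set h := a ^ 2 * τ / 2 with hh_def
  have hh : 0 < h := by positivity
  have hthr : l₀ * τ + N * l₀ * h ≤ a := by
    have : N * l₀ * h = N * (l₀ * τ) * (a ^ 2 / 2) := by rw [hh_def]; ring
    rw [this]
    nlinarith [sq_nonneg a]
  refine (measure_mono fun s hs ↦ lt_of_le_of_lt hthr hs).trans
    ((measure_lt_abs_klRobust_sub_klSAA_le_of_grid hn0 hX hb hτ hl₀ hh.le hN).trans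
      (ENNReal.ofReal_le_ofReal ?_))
  have hl₀inv : l₀⁻¹ ≤ τ / a + 2 * τ := by
    rw [hl₀_def, inv_div, div_le_iff₀ (by linarith), div_add' _ _ _ ha.ne', div_mul_eq_mul_div,
      le_div_iff₀ ha]
    have : 0 ≤ τ * (a ^ 2 * (1 - 2 * a)) := by
      have : 0 ≤ 1 - 2 * a := by linarith
      positivity
    linarith
  have hhτ : h ≤ τ := by
    have : a ^ 2 ≤ 1 := by nlinarith
    rw [hh_def]
    nlinarith
  set c := exp (-l₀⁻¹) * (exp (-h) * (h ^ 2 / 2)) with hc_def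
  have hc : exp (-(τ / a)) * exp (-(3 * τ)) * (a ^ 4 * τ ^ 2 / 8) ≤ c := by
    have h1 : c = exp (-l₀⁻¹ + -h) * (a ^ 4 * τ ^ 2 / 8) := by
      rw [hc_def, exp_add, hh_def]
      ring
    rw [h1, ← exp_add]
    exact mul_le_mul_of_nonneg_right (exp_le_exp.mpr (by linarith)) (by positivity)
  have hnc : 6 / a * log (2 / δ) ≤ n * c := by
    calc 6 / a * log (2 / δ)
        = (48 * exp (3 * τ) / τ ^ 6 * (a⁻¹ * exp (τ / a)) * (τ / a) ^ 4 * log (2 / δ))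
          * (exp (-(τ / a)) * exp (-(3 * τ)) * (a ^ 4 * τ ^ 2 / 8)) := by
          rw [exp_neg, exp_neg]
          field_simp
          norm_num
      _ ≤ n * c := mul_le_mul hn hc (by positivity) n.cast_nonneg
  -- The union bound over the grid, with the crude `log N ≤ N - 1`; `log (2 / δ) ≥ 1 / 2` absorbs it
  -- into `2 * N * log (2 / δ)`.
  have hlogN : log (N * 2 / δ) ≤ n * c := by
    rw [mul_div_assoc, log_mul hN0.ne' (by positivity)]
    have h1 := log_le_sub_one_of_pos hN0
    have h2 : (N : ℝ) ≤ 3 / a := (le_div_iff₀ ha).mpr hNa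
    have h3 : 2 * (N : ℝ) * log (2 / δ) ≤ 6 / a * log (2 / δ) := by
      have : 2 * (N : ℝ) ≤ 6 / a := by
        have : 6 / a = 2 * (3 / a) := by ring
        linarith
      gcongr
    have hN1 : (1 : ℝ) ≤ N := by
      have : 0 < N := by exact_mod_cast hN0
      exact_mod_cast this
    nlinarith
  rw [log_le_iff_le_exp (by positivity), div_le_iff₀ hδ] at hlogN
  calc (N : ℝ) * (2 * exp (-(n * exp (-l₀⁻¹) * (exp (-h) * (h ^ 2 / 2)))))
      = N * 2 * exp (-(n * c)) := by rw [hc_def]; ring_nf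
    _ ≤ exp (n * c) * δ * exp (-(n * c)) := by gcongr
    _ = δ := by rw [exp_neg]; field_simp

lemma klRate_eq {B ε : ℝ} : klRate B τ ε = (ε / (2 * B))⁻¹ * exp (τ / (ε / (2 * B))) := by
  rw [klRate, inv_div, div_div_eq_mul_div, mul_comm τ]

end Concentration

/-! ### Rescaling to `[0, 1]` and assembly. -/

theorem mainTheorem8 :
    -- upper bound: SAA is `ε`-accurate with probability at least `1 - δ`
    (∃ k : ℕ, ∀ τ : ℝ, 0 < τ → ∃ C : ℝ, 0 < C ∧
      ∀ (Ω : Type*) [MeasurableSpace Ω] (P : Measure Ω) [IsProbabilityMeasure P]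
        (B : ℝ) (X : Ω → ℝ), Measurable X → (∀ ω, X ω ∈ Set.Icc (-B) B) →
      ∀ ε δ : ℝ, 0 < ε → ε ≤ B → 0 < δ → δ < 1 →
      ∀ n : ℕ, C * klRate B τ ε * Real.log (klRate B τ ε) ^ k * Real.log (2 / δ) ≤ (n : ℝ) →
        Measure.pi (fun _ : Fin n => P) {s | ε < |klRobust P τ X - klSAA τ X s|}
          ≤ ENNReal.ofReal δ) ∧
    -- lower bounds, on a two-point sample space
    (∀ τ B ε : ℝ, 0 < τ → 0 < ε → ε ≤ B →
      ∀ n : ℕ, (n : ℝ) ≤ klRate B τ ε / 2 →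
        -- every estimator fails to be `ε / 2`-accurate for some nominal measure
        (∀ estimator : (Fin n → Bool) → ℝ, Measurable estimator →
          ∃ P : Measure Bool, IsProbabilityMeasure P ∧
            1 / 2 ≤ Measure.pi (fun _ : Fin n => P)
              {s | ε / 2 < |klRobust P τ (fun b => if b then B else -B) - estimator s|}) ∧
        -- SAA fails to be `ε`-accurate for some nominal measure
        (0 < n → ∃ P : Measure Bool, IsProbabilityMeasure P ∧
          1 / 2 ≤ Measure.pi (fun _ : Fin n => P)
            {s | ε < |klRobust P τ (fun b => if b then B else -B)
              - klSAA τ (fun b => if b then B else -B) s|})) := by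
  -- The exponent 4 comes from `h ^ 2`, of order `a ^ 4`; the grid size supplies the `a⁻¹` in the
  -- rate. Powers of `τ / a` are at most those of the logarithm of the rate.
  refine ⟨⟨4, fun τ hτ ↦ ⟨48 * Real.exp (3 * τ) / τ ^ 6, by positivity, ?_⟩⟩, ?_⟩
  · intro Ω _ P _ B X hX hb ε δ hε hεB hδ hδ1 n hn
    have hB : 0 < B := hε.trans_le hεB
    set a := ε / (2 * B) with ha_def
    have ha : 0 < a := by positivity
    have ha2 : a ≤ 1 / 2 := by
      rw [ha_def, div_le_iff₀ (by positivity)]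
      linarith
    set Y : Ω → ℝ := fun ω ↦ (X ω + B) / (2 * B) with hY_def
    have hY : Measurable Y := (hX.add_const B).div_const _
    have hYb : ∀ ω, Y ω ∈ Set.Icc 0 1 := by
      intro ω
      obtain ⟨h1, h2⟩ := hb ω
      exact ⟨div_nonneg (by linarith) (by positivity),
        (div_le_one (by positivity)).mpr (by linarith)⟩
    have hXY : X = fun ω ↦ 2 * B * Y ω + -B := by
      ext ω
      rw [hY_def]
      field_simp
      ring
    have hlog : 0 < Real.log (2 / δ) :=
      Real.log_pos ((one_lt_div hδ).mpr (by linarith))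
    have hrate : τ / a ≤ Real.log (klRate B τ ε) := by
      rw [klRate_eq, ← ha_def, Real.log_mul (by positivity) (Real.exp_pos _).ne', Real.log_exp]
      have : 0 ≤ Real.log a⁻¹ :=
        Real.log_nonneg ((one_le_inv₀ ha).mpr (by linarith))
      linarith
    have hn0 : 0 < n := by
      have h0 : 0 < τ / a := by positivity
      have : (0 : ℝ) < n := by
        refine lt_of_lt_of_le ?_ hn
        have := h0.trans_le hrate
        have : 0 < klRate B τ ε := by
          rw [klRate_eq]
          positivity
        positivity
      exact_mod_cast this
    refine (measure_mono fun s hs ↦ ?_).trans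
      (measure_lt_abs_klRobust_sub_klSAA_le (P := P) hY hYb hτ ha ha2 hδ hδ1 (le_trans ?_ hn))
    · have := isProbabilityMeasure_empiricalDistribution hn0 s
      rw [Set.mem_ofPred_eq] at hs ⊢
      rw [klSAA, hXY, klRobust_const_mul_add hY hYb (by positivity),
        klRobust_const_mul_add hY hYb (by positivity), add_sub_add_right_eq_sub, ← mul_sub,
        abs_mul, abs_of_pos (show 0 < 2 * B by positivity)] at hs
      rw [ha_def, div_lt_iff₀ (by positivity), mul_comm]
      exact hs
    · rw [klRate_eq] at hrate ⊢
      gcongr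
  · intro τ B ε hτ hε hεB n hn
    obtain ⟨p, hp0, hp1, hnp, hlt⟩ := exists_twoPoint_klRobust hτ hε hεB hn
    have hprob := isProbabilityMeasure_twoPoint hp0 hp1
    refine ⟨fun estimator _ ↦ ?_, fun hn0 ↦ ⟨twoPoint p, hprob, ?_⟩⟩
    · by_cases h : ε / 2 < |-B - estimator fun _ ↦ false|
      · refine ⟨twoPoint 0, isProbabilityMeasure_twoPoint le_rfl zero_le_one,
          half_le_pi_twoPoint_of_mem le_rfl zero_le_one (by norm_num) ?_⟩
        rw [Set.mem_ofPred_eq, show twoPoint 0 = Measure.dirac false by simp [twoPoint],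
          klRobust_dirac]
        simpa using h
      · refine ⟨twoPoint p, hprob, half_le_pi_twoPoint_of_mem hp0 hp1 hnp ?_⟩
        rw [not_lt, abs_le] at h
        rw [Set.mem_ofPred_eq]
        exact lt_of_lt_of_le (by linarith [h.1]) (le_abs_self _)
    · refine half_le_pi_twoPoint_of_mem hp0 hp1 hnp ?_
      rw [Set.mem_ofPred_eq, klSAA, empiricalDistribution_const hn0, klRobust_dirac]
      refine lt_of_lt_of_le ?_ (le_abs_self _)
      simp only [Bool.false_eq_true, if_false]
      linarith
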